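/- Let $\mathcal H$ be a complex Hilbert space and let $H_0\ge I$ be a self-adjoint operator on $\mathcal H$ with domain $\mathcal D(H_0)$. Let $R_0=H_0^{-1}$ be its (bounded, everywhere defined) resolvent at the origin, $Q_0=\mathcal D(H_0^{1/2})$ its form domain and $q_0(\phi,\psi)=\langle H_0^{1/2}\phi,H_0^{1/2}\psi\rangle$ its quadratic form. An operator $X$ is called $H_0$-bounded if $\mathcal D(H_0)\subset\mathcal D(X)$ and there are constants $a,b>0$ with $\|X\psi\|\le a\|H_0\psi\|+b\|\psi\|$ for all $\psi\in\mathcal D(H_0)$. A symmetric quadratic form $X$ with domain $Q(X)$ (identified with the symmetric sesquilinear form obtained by polarization) is called $q_0$-bounded if $Q_0\subset Q(X)$ and there are constants $a,b>0$ with $|X(\psi,\psi)|\le a\,q_0(\psi,\psi)+b\langle\psi,\psi\rangle$ for all $\psi\in Q_0$; the infimum of such $a$ is the relative bound of $X$ with respect to $q_0$. For operators $A,B$ with $A^*$ and $B$ densely defined, $AXB$ denotes the form $(\phi,\psi)\mapsto X(A^*\phi,B\psi)$, defined for $\phi\in\mathcal D(A^*)$ with $A^*\phi\in Q(X)$ and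 $\psi\in\mathcal D(B)$ with $B\psi\in Q(X)$. The norm of a form $Y$ is $\|Y\|=\sup\{|Y(\phi,\psi)| : \|\phi\|\le1,\ \|\psi\|\le1\}\in[0,\infty]$, with $\phi,\psi$ in the domains of its variables, and $Y$ is bounded if $\|Y\|<\infty$. Then: (1) A symmetric operator $X:\mathcal D(H_0)\to\mathcal H$ is $H_0$-bounded if and only if $\|XR_0\|<\infty$. (2) A symmetric quadratic form $X$ defined on $Q_0$ is $q_0$-bounded if and only if $R_0^{1/2}XR_0^{1/2}$ is a bounded symmetric form defined everywhere on $\mathcal H$. (3) If $X$ is a symmetric quadratic form on $Q_0$ and $\|R_0^{1/2}XR_0^{1/2}\|<\infty$, then the relative bound $a$ of $X$ with respect to $q_0$ satisfies $a\le\|R_0^{1/2}XR_0^{1/2}\|$. -/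

import Mathlib

open scoped ENNReal InnerProductSpace ComplexConjugate

noncomputable section

namespace RelBdd

variable {H : Type*} [NormedAddCommGroup H] [InnerProductSpace ℂ H]

/-! ### Unbounded operators

An operator on `H` is a linear map defined on a subspace of `H`, that is, a term of `H →ₗ.[ℂ] H`.
Its adjoint, and hence self-adjointness, is the one of Mathlib. -/

/-- The set of all `x` in the domain of `f` such that `f x` belongs to the subspace `p`. -/
def pullback (f : H →ₗ.[ℂ] H) (p : Submodule ℂ H) : Submodule ℂ H where
  carrier := {x | ∃ h : x ∈ f.domain, f ⟨x, h⟩ ∈ p}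
  zero_mem' := by
    refine ⟨f.domain.zero_mem, ?_⟩
    have : f ⟨0, f.domain.zero_mem⟩ = 0 := f.map_zero
    rw [this]
    exact p.zero_mem
  add_mem' := by
    rintro x y ⟨hx, hx'⟩ ⟨hy, hy'⟩
    refine ⟨f.domain.add_mem hx hy, ?_⟩
    have : f ⟨x + y, f.domain.add_mem hx hy⟩ = f ⟨x, hx⟩ + f ⟨y, hy⟩ := f.map_add ⟨x, hx⟩ ⟨y, hy⟩
    rw [this]
    exact p.add_mem hx' hy'
  smul_mem' := by
    rintro c x ⟨hx, hx'⟩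
    refine ⟨f.domain.smul_mem c hx, ?_⟩
    have : f ⟨c • x, f.domain.smul_mem c hx⟩ = c • f ⟨x, hx⟩ := f.map_smul c ⟨x, hx⟩
    rw [this]
    exact p.smul_mem c hx'

/-- `f` as a linear map from `pullback f p` to `p`. -/
def restr (f : H →ₗ.[ℂ] H) (p : Submodule ℂ H) : pullback f p →ₗ[ℂ] p where
  toFun x := ⟨f ⟨x, x.2.fst⟩, x.2.snd⟩
  map_add' x y := Subtype.ext (f.map_add ⟨x, x.2.fst⟩ ⟨y, y.2.fst⟩)
  map_smul' c x := Subtype.ext (f.map_smul c ⟨x, x.2.fst⟩)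

/-- The product `g f` of two unbounded operators, on its natural domain
`{x ∈ D(f) | f x ∈ D(g)}`. -/
def opComp (g f : H →ₗ.[ℂ] H) : H →ₗ.[ℂ] H where
  domain := pullback f g.domain
  toFun := g.toFun ∘ₗ restr f g.domain

/-- A bounded operator, seen as an operator with domain `H`. -/
def ofBounded (A : H →L[ℂ] H) : H →ₗ.[ℂ] H := (A : H →ₗ[ℂ] H).toPMap ⊤

theorem graph_opComp (g f : H →ₗ.[ℂ] H) (x z : H) :
    (x, z) ∈ (opComp g f).graph ↔ ∃ y, (x, y) ∈ f.graph ∧ (y, z) ∈ g.graph := by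
  constructor
  · intro h
    obtain ⟨w, hw, hwz⟩ := ((opComp g f).mem_graph_iff).1 h
    obtain ⟨w, hw1, hw2⟩ := w
    subst hw
    refine ⟨f ⟨w, hw1⟩, f.mem_graph ⟨w, hw1⟩, ?_⟩
    have h2 : g ⟨f ⟨w, hw1⟩, hw2⟩ = z := hwz
    rw [← h2]
    exact g.mem_graph ⟨f ⟨w, hw1⟩, hw2⟩
  · rintro ⟨y, hxy, hyz⟩
    obtain ⟨v, hv, hvy⟩ := (f.mem_graph_iff).1 hxy
    obtain ⟨w, hw, hwz⟩ := (g.mem_graph_iff).1 hyz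
    simp only at hv hvy hw hwz
    subst hv hvy hwz
    have hm : (v : H) ∈ (opComp g f).domain := ⟨v.2, hw ▸ w.2⟩
    rw [LinearPMap.mem_graph_iff]
    refine ⟨⟨v, hm⟩, rfl, ?_⟩
    have : w = ⟨f v, hw ▸ w.2⟩ := Subtype.ext hw
    rw [this]
    rfl

/-- The norm, possibly infinite, of an operator `T`: the supremum of `‖T x‖` over all `x` in the
domain with `‖x‖ ≤ 1`. -/
def opNorm (T : H →ₗ.[ℂ] H) : ℝ≥0∞ :=
  ⨆ (x : T.domain) (_ : ‖(x : H)‖ ≤ 1), ‖T x‖ₑ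

/-- `T ≥ I`, that is, `⟪ψ, T ψ⟫ ≥ ⟪ψ, ψ⟫` on the domain of `T`. -/
def GeOne (T : H →ₗ.[ℂ] H) : Prop :=
  ∀ ψ : T.domain, ‖(ψ : H)‖ ^ 2 ≤ (⟪(ψ : H), T ψ⟫_ℂ).re

theorem GeOne.norm_le {T : H →ₗ.[ℂ] H} (h1 : GeOne T) (ψ : T.domain) : ‖(ψ : H)‖ ≤ ‖T ψ‖ := by
  have h := h1 ψ
  have h2 : (⟪(ψ : H), T ψ⟫_ℂ).re ≤ ‖(ψ : H)‖ * ‖T ψ‖ :=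
    (Complex.re_le_norm _).trans (norm_inner_le_norm _ _)
  by_contra! hlt
  have h0 : 0 < ‖(ψ : H)‖ := (norm_nonneg _).trans_lt hlt
  nlinarith

theorem GeOne.injective {T : H →ₗ.[ℂ] H} (h1 : GeOne T) : Function.Injective T.toFun := by
  rw [← LinearMap.ker_eq_bot, LinearMap.ker_eq_bot']
  intro ψ hψ
  have h := h1.norm_le ψ
  have h2 : T ψ = 0 := hψ
  rw [h2, norm_zero] at h
  exact Subtype.ext (norm_le_zero_iff.1 h)

/-- `T ≥ 0`, that is, `⟪ψ, T ψ⟫ ≥ 0` on the domain of `T`. -/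
def Pos (T : H →ₗ.[ℂ] H) : Prop :=
  ∀ ψ : T.domain, 0 ≤ (⟪(ψ : H), T ψ⟫_ℂ).re

/-- Symmetric operators. -/
def IsSymmetricOp (X : H →ₗ.[ℂ] H) : Prop :=
  ∀ φ ψ : X.domain, ⟪X φ, (ψ : H)⟫_ℂ = ⟪(φ : H), X ψ⟫_ℂ

/-- The operator `X` is `T`-bounded. -/
def IsOpBounded (T X : H →ₗ.[ℂ] H) : Prop :=
  ∃ hD : T.domain ≤ X.domain, ∃ a b : ℝ, 0 < a ∧ 0 < b ∧
    ∀ ψ : T.domain, ‖X ⟨ψ, hD ψ.2⟩‖ ≤ a * ‖T ψ‖ + b * ‖(ψ : H)‖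

/-! ### Forms -/

/-- A sesquilinear form with a domain, conjugate linear in the first variable. By polarization,
this is the same as a quadratic form `ψ ↦ X (ψ, ψ)` on the domain. -/
structure SesqForm (H : Type*) [NormedAddCommGroup H] [InnerProductSpace ℂ H] where
  /-- the form domain -/
  domain : Submodule ℂ H
  /-- the values of the form -/
  toFun : domain →ₗ⋆[ℂ] domain →ₗ[ℂ] ℂ

/-- Symmetric forms. -/
def SesqForm.IsSymm (X : SesqForm H) : Prop :=
  ∀ φ ψ : X.domain, conj (X.toFun φ ψ) = X.toFun ψ φ

/-- `a > 0` is admissible in the estimate `|X(ψ,ψ)| ≤ a q(ψ,ψ) + b (ψ,ψ)` on the domain of `q`,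
for some `b > 0`. -/
def IsFormBoundedWith (q X : SesqForm H) (a : ℝ) : Prop :=
  0 < a ∧ ∃ hD : q.domain ≤ X.domain, ∃ b : ℝ, 0 < b ∧
    ∀ ψ : q.domain, ‖X.toFun ⟨ψ, hD ψ.2⟩ ⟨ψ, hD ψ.2⟩‖ ≤
      a * (q.toFun ψ ψ).re + b * ‖(ψ : H)‖ ^ 2

/-- The form `X` is `q`-bounded. -/
def IsFormBounded (q X : SesqForm H) : Prop := ∃ a : ℝ, IsFormBoundedWith q X a

/-- The relative bound of `X` with respect to `q`: the infimum of the admissible `a`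
(it is `∞` if there is none). -/
def formRelBound (q X : SesqForm H) : ℝ≥0∞ :=
  ⨅ (a : ℝ) (_ : IsFormBoundedWith q X a), ENNReal.ofReal a

/-- A sesquilinear form `φ, ψ ↦ Y (φ, ψ)` whose variables range over two subspaces. -/
structure PairForm (H : Type*) [NormedAddCommGroup H] [InnerProductSpace ℂ H] where
  /-- the domain of the first variable -/
  left : Submodule ℂ H
  /-- the domain of the second variable -/
  right : Submodule ℂ H
  /-- the values of the form -/
  toFun : left →ₗ⋆[ℂ] right →ₗ[ℂ] ℂ

/-- The form is defined everywhere. -/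
def PairForm.IsEverywhereDefined (Y : PairForm H) : Prop := Y.left = ⊤ ∧ Y.right = ⊤

/-- The form is symmetric: both variables have the same domain and
`Y (φ, ψ)` is the conjugate of `Y (ψ, φ)`. -/
def PairForm.IsSymm (Y : PairForm H) : Prop :=
  ∃ h : Y.left = Y.right, ∀ φ ψ : Y.left,
    conj (Y.toFun φ ⟨ψ, h ▸ ψ.2⟩) = Y.toFun ψ ⟨φ, h ▸ φ.2⟩

/-- The norm, possibly infinite, of a form: the supremum of `|Y (φ, ψ)|` over all `φ`, `ψ` in the
domains with `‖φ‖ ≤ 1` and `‖ψ‖ ≤ 1`. -/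
def PairForm.norm (Y : PairForm H) : ℝ≥0∞ :=
  ⨆ (φ : Y.left) (ψ : Y.right) (_ : ‖(φ : H)‖ ≤ 1) (_ : ‖(ψ : H)‖ ≤ 1), ‖Y.toFun φ ψ‖ₑ

/-- The form is bounded. -/
def PairForm.IsBounded (Y : PairForm H) : Prop := Y.norm < ∞

variable [CompleteSpace H]

/-- The form `A X B`, namely `φ, ψ ↦ X (A* φ, B ψ)`, on its natural domain: `φ ∈ D(A*)` with
`A* φ ∈ Q(X)` and `ψ ∈ D(B)` with `B ψ ∈ Q(X)`. -/
def sandwich (A : H →ₗ.[ℂ] H) (X : SesqForm H) (B : H →ₗ.[ℂ] H) : PairForm H where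
  left := pullback A.adjoint X.domain
  right := pullback B X.domain
  toFun := LinearMap.mk₂'ₛₗ (starRingEnd ℂ) (RingHom.id ℂ)
    (fun φ ψ => X.toFun (restr A.adjoint X.domain φ) (restr B X.domain ψ))
    (fun _ _ _ => by simp) (fun _ _ _ => by simp) (fun _ _ _ => by simp) (fun _ _ _ => by simp)

/-! ### The bounded inverse of a self-adjoint operator `T ≥ I` -/

theorem surjective_of_geOne {T : H →ₗ.[ℂ] H} (hT : IsSelfAdjoint T) (h1 : GeOne T) :
    Function.Surjective T.toFun := by
  have hcl : IsClosed (LinearMap.range T.toFun : Set H) := by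
    rw [← isSeqClosed_iff_isClosed]
    intro u y hu huy
    choose x hx using hu
    have hx' : ∀ n, T (x n) = u n := hx
    have hc : CauchySeq fun n => (x n : H) := by
      rw [Metric.cauchySeq_iff']
      intro ε hε
      obtain ⟨N, hN⟩ := Metric.cauchySeq_iff'.1 huy.cauchySeq ε hε
      refine ⟨N, fun n hn => lt_of_le_of_lt ?_ (hN n hn)⟩
      rw [dist_eq_norm, dist_eq_norm, ← hx', ← hx', ← T.map_sub]
      exact h1.norm_le (x n - x N)
    obtain ⟨z, hz⟩ := cauchySeq_tendsto_of_complete hc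
    have hgc : IsClosed (T.graph : Set (H × H)) := hT.isClosed
    have hmem : (z, y) ∈ T.graph := by
      refine hgc.mem_of_tendsto (hz.prodMk_nhds huy) (Filter.Eventually.of_forall fun n => ?_)
      rw [← hx' n]
      exact T.mem_graph (x n)
    obtain ⟨w, -, hw⟩ := (T.mem_graph_iff).1 hmem
    exact ⟨w, hw⟩
  have hd := hT.dense_domain
  have horth : (LinearMap.range T.toFun)ᗮ = ⊥ := by
    rw [Submodule.eq_bot_iff]
    intro y hy
    have hy0 : ∀ x : T.domain, ⟪y, T x⟫_ℂ = 0 := fun x =>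
      Submodule.inner_left_of_mem_orthogonal (LinearMap.mem_range_self T.toFun x) hy
    have hg : (y, (0 : H)) ∈ T.graph := by
      have : (y, (0 : H)) ∈ T.adjoint.graph := by
        rw [LinearPMap.adjoint_graph_eq_graph_adjoint hd, Submodule.mem_adjoint_iff]
        intro a b hab
        obtain ⟨x, -, hxb⟩ := (T.mem_graph_iff).1 hab
        have h3 : b = T x := hxb.symm
        have h4 : ⟪T x, y⟫_ℂ = 0 := by rw [← inner_conj_symm, hy0 x, map_zero]
        simp [h3, h4]
      rwa [(LinearPMap.isSelfAdjoint_def).1 hT] at this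
    obtain ⟨w, hw, hw0⟩ := (T.mem_graph_iff).1 hg
    have h5 := h1.norm_le w
    have hw' : (w : H) = y := hw
    have hw0' : T w = 0 := hw0
    rw [hw0', norm_zero, hw'] at h5
    exact norm_le_zero_iff.1 h5
  have : LinearMap.range T.toFun = ⊤ := by
    have : CompleteSpace (LinearMap.range T.toFun) := hcl.completeSpace_coe
    exact Submodule.orthogonal_eq_bot_iff.1 horth
  exact LinearMap.range_eq_top.1 this

/-- The resolvent at the origin, `T⁻¹`, as a bounded operator on `H`. -/
def resolventZero (T : H →ₗ.[ℂ] H) (hT : IsSelfAdjoint T) (h1 : GeOne T) : H →L[ℂ] H :=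
  LinearMap.mkContinuous
    (T.domain.subtype ∘ₗ
      (LinearEquiv.ofBijective T.toFun ⟨h1.injective, surjective_of_geOne hT h1⟩).symm.toLinearMap)
    1 fun φ => by
      rw [one_mul]
      refine (h1.norm_le _).trans (le_of_eq ?_)
      exact congrArg norm
        ((LinearEquiv.ofBijective T.toFun
          ⟨h1.injective, surjective_of_geOne hT h1⟩).apply_symm_apply φ)

theorem graph_resolventZero {T : H →ₗ.[ℂ] H} (hT : IsSelfAdjoint T) (h1 : GeOne T) (φ : H) : (resolventZero T hT h1 φ, φ) ∈ T.graph := by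
  rw [LinearPMap.mem_graph_iff]
  exact ⟨_, rfl, (LinearEquiv.ofBijective T.toFun
          ⟨h1.injective, surjective_of_geOne hT h1⟩).apply_symm_apply φ⟩

theorem graph_iff_resolventZero {T : H →ₗ.[ℂ] H} (hT : IsSelfAdjoint T) (h1 : GeOne T) (x y : H) :
    (x, y) ∈ T.graph ↔ x = resolventZero T hT h1 y := by
  constructor
  · intro h
    obtain ⟨w, hw, hwy⟩ := (T.mem_graph_iff).1 h
    obtain ⟨v, hv, hvy⟩ := (T.mem_graph_iff).1 (graph_resolventZero hT h1 y)
    have : w = v := h1.injective (hwy.trans hvy.symm)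
    rw [this] at hw
    exact hw.symm.trans hv
  · rintro rfl
    exact graph_resolventZero hT h1 y

theorem isSymm_of_isSelfAdjoint {S : H →ₗ.[ℂ] H} (hS : IsSelfAdjoint S) : IsSymmetricOp S := by
  have h := LinearPMap.adjoint_isFormalAdjoint hS.dense_domain
  rw [(LinearPMap.isSelfAdjoint_def).1 hS] at h
  exact h

theorem resolventZero_nonneg {T : H →ₗ.[ℂ] H} (hT : IsSelfAdjoint T) (h1 : GeOne T) : 0 ≤ resolventZero T hT h1 := by
  rw [ContinuousLinearMap.nonneg_iff_isPositive, ContinuousLinearMap.isPositive_def]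
  constructor
  · intro x y
    obtain ⟨v, hv, hvx⟩ := (T.mem_graph_iff).1 (graph_resolventZero hT h1 x)
    obtain ⟨w, hw, hwy⟩ := (T.mem_graph_iff).1 (graph_resolventZero hT h1 y)
    have h := isSymm_of_isSelfAdjoint hT v w
    simp only at hv hvx hw hwy
    rw [hv, hvx, hw, hwy] at h
    exact h.symm
  · intro x
    obtain ⟨v, hv, hvx⟩ := (T.mem_graph_iff).1 (graph_resolventZero hT h1 x)
    have h := (sq_nonneg _).trans (h1 v)
    simp only at hv hvx
    rw [hv, hvx] at h
    exact h

/-! ### The square root and the quadratic form of a self-adjoint operator -/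

/-- `S` is the positive self-adjoint square root of `T`: `S` is self-adjoint, `S ≥ 0` and
`S² = T`, with equality of domains. -/
structure IsOpSqrt (S T : H →ₗ.[ℂ] H) : Prop where
  isSelfAdjoint : IsSelfAdjoint S
  pos : Pos S
  comp_self : opComp S S = T

theorem sqrt_resolventZero_apply {T : H →ₗ.[ℂ] H} (hT : IsSelfAdjoint T) (h1 : GeOne T) (x : H) :
    CFC.sqrt (resolventZero T hT h1) (CFC.sqrt (resolventZero T hT h1) x) =
      resolventZero T hT h1 x :=
  DFunLike.congr_fun (CFC.sqrt_mul_sqrt_self _ (resolventZero_nonneg hT h1)) x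

theorem exists_isOpSqrt {T : H →ₗ.[ℂ] H} (hT : IsSelfAdjoint T) (h1 : GeOne T) : ∃ S : H →ₗ.[ℂ] H, IsOpSqrt S T := by
  set A := CFC.sqrt (resolventZero T hT h1) with hA
  have hA0 : A.IsPositive :=
    (ContinuousLinearMap.nonneg_iff_isPositive _).1 (CFC.sqrt_nonneg _)
  have hAs : ∀ x y, ⟪A x, y⟫_ℂ = ⟪x, A y⟫_ℂ := fun x y => hA0.isSymmetric x y
  have hAA : ∀ x, A (A x) = resolventZero T hT h1 x := sqrt_resolventZero_apply hT h1
  have hinj : ∀ x, A x = 0 → x = 0 := by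
    intro x hx
    have h0 : resolventZero T hT h1 x = 0 := by rw [← hAA, hx, map_zero]
    have hg := graph_resolventZero hT h1 x
    rw [h0] at hg
    exact T.graph_fst_eq_zero_snd hg rfl
  have hker : LinearMap.ker ((A : H →ₗ[ℂ] H).toPMap ⊤).toFun = ⊥ := by
    rw [LinearMap.ker_eq_bot']
    intro m hm
    exact Subtype.ext (hinj m hm)
  set S := ((A : H →ₗ[ℂ] H).toPMap ⊤).inverse with hS
  have hgr : ∀ x y, (x, y) ∈ S.graph ↔ x = A y := by
    intro x y
    rw [hS, LinearPMap.inverse_graph hker]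
    simp only [Submodule.mem_map, LinearPMap.mem_graph_iff]
    constructor
    · rintro ⟨⟨a, b⟩, ⟨w, hw, hwb⟩, h⟩
      simp only at hw hwb
      subst hw hwb
      have h' := Prod.ext_iff.1 h
      obtain ⟨h3, h4⟩ := h'
      have h3 : A w = x := h3
      have h4 : (w : H) = y := h4
      rw [← h3, h4]
    · rintro rfl
      exact ⟨(y, A y), ⟨⟨y, trivial⟩, rfl, rfl⟩, rfl⟩
  have hSS : opComp S S = T := by
    apply LinearPMap.eq_of_eq_graph
    ext ⟨x, z⟩
    rw [graph_opComp, graph_iff_resolventZero hT h1, ← hAA]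
    simp [hgr]
  have hdense : Dense (S.domain : Set H) := by
    refine hT.dense_domain.mono fun x hx => ?_
    rw [← hSS] at hx
    exact hx.fst
  have hsa : IsSelfAdjoint S := by
    rw [LinearPMap.isSelfAdjoint_def]
    apply LinearPMap.eq_of_eq_graph
    rw [LinearPMap.adjoint_graph_eq_graph_adjoint hdense]
    ext ⟨y, z⟩
    rw [Submodule.mem_adjoint_iff, hgr]
    simp only [hgr]
    constructor
    · intro h
      refine ext_inner_left ℂ fun b => ?_
      have := h (A b) b rfl
      rw [sub_eq_zero, hAs] at this
      exact this
    · rintro rfl a b rfl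
      rw [hAs, sub_self]
  refine ⟨S, hsa, ?_, hSS⟩
  intro ψ
  have h := (hgr _ _).1 (S.mem_graph ψ)
  rw [h]
  exact hA0.re_inner_nonneg_left (S ψ)

/-- Square roots are unique, and their graph is read off from the square root of the bounded
inverse. -/
theorem IsOpSqrt.graph_iff {T : H →ₗ.[ℂ] H} (hT : IsSelfAdjoint T) (h1 : GeOne T) {S : H →ₗ.[ℂ] H} (hS : IsOpSqrt S T) (x y : H) :
    (x, y) ∈ S.graph ↔ x = CFC.sqrt (resolventZero T hT h1) y := by
  have hsurj : Function.Surjective S.toFun := by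
    intro y
    have h := graph_resolventZero hT h1 y
    have hle : T.graph ≤ (opComp S S).graph := by rw [hS.comp_self]
    obtain ⟨u, -, hu⟩ := (graph_opComp S S _ _).1 (hle h)
    obtain ⟨w, -, hw⟩ := (S.mem_graph_iff).1 hu
    exact ⟨w, hw⟩
  have hsym := isSymm_of_isSelfAdjoint hS.isSelfAdjoint
  have hinj : Function.Injective S.toFun := by
    rw [← LinearMap.ker_eq_bot, LinearMap.ker_eq_bot']
    intro m hm
    obtain ⟨w, hw⟩ := hsurj m
    have hm' : S m = 0 := hm
    have hw' : S w = m := hw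
    have h := hsym w m
    rw [hm', hw', inner_zero_right] at h
    exact Subtype.ext (inner_self_eq_zero.1 h)
  set e := LinearEquiv.ofBijective S.toFun ⟨hinj, hsurj⟩ with he
  have hSe : ∀ x, S (e.symm x) = x := fun x => e.apply_symm_apply x
  set B : H →ₗ[ℂ] H := S.domain.subtype ∘ₗ e.symm.toLinearMap with hB
  have hBe : ∀ x, B x = e.symm x := fun x => rfl
  have hBs : B.IsSymmetric := by
    intro x y
    rw [hBe, hBe]
    have h := hsym (e.symm x) (e.symm y)
    rw [hSe, hSe] at h
    exact h.symm
  have hgB : ∀ x y, (x, y) ∈ S.graph ↔ x = B y := by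
    intro x y
    constructor
    · intro h
      obtain ⟨w, hw, hwy⟩ := (S.mem_graph_iff).1 h
      simp only at hw hwy
      rw [hBe, ← hw]
      have : w = e.symm y := by
        rw [LinearEquiv.eq_symm_apply]
        exact hwy
      rw [this]
    · rintro rfl
      rw [LinearPMap.mem_graph_iff]
      exact ⟨e.symm y, rfl, hSe y⟩
  let C : H →L[ℂ] H := ⟨B, hBs.continuous⟩
  have hC0 : 0 ≤ C := by
    rw [ContinuousLinearMap.nonneg_iff_isPositive, ContinuousLinearMap.isPositive_def]
    refine ⟨hBs, fun x => ?_⟩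
    have h := hS.pos (e.symm x)
    rw [hSe] at h
    exact h
  have hCC : C * C = resolventZero T hT h1 := by
    ext z
    have h : (C (C z), z) ∈ T.graph := by
      rw [← hS.comp_self, graph_opComp]
      exact ⟨B z, (hgB _ _).2 rfl, (hgB _ _).2 rfl⟩
    exact (graph_iff_resolventZero hT h1 _ _).1 h
  rw [CFC.sqrt_unique hCC hC0, hgB]
  rfl

theorem IsOpSqrt.unique {T : H →ₗ.[ℂ] H} (hT : IsSelfAdjoint T) (h1 : GeOne T) {S S' : H →ₗ.[ℂ] H} (hS : IsOpSqrt S T) (hS' : IsOpSqrt S' T) :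
    S = S' := by
  apply LinearPMap.eq_of_eq_graph
  ext ⟨x, y⟩
  rw [hS.graph_iff hT h1, hS'.graph_iff hT h1]

/-- `T^{1/2}`: the positive self-adjoint square root of a self-adjoint operator `T ≥ I`. -/
def opSqrt (T : H →ₗ.[ℂ] H) (hT : IsSelfAdjoint T) (h1 : GeOne T) : H →ₗ.[ℂ] H :=
  (exists_isOpSqrt hT h1).choose

theorem isOpSqrt_opSqrt {T : H →ₗ.[ℂ] H} (hT : IsSelfAdjoint T) (h1 : GeOne T) :
    IsOpSqrt (opSqrt T hT h1) T :=
  (exists_isOpSqrt hT h1).choose_spec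

/-- The quadratic form of a self-adjoint operator `T ≥ I`: its domain is the domain of `T^{1/2}`
and its value at `φ, ψ` is `⟪T^{1/2} φ, T^{1/2} ψ⟫`. -/
def formOf (T : H →ₗ.[ℂ] H) (hT : IsSelfAdjoint T) (h1 : GeOne T) : SesqForm H where
  domain := (opSqrt T hT h1).domain
  toFun := LinearMap.mk₂'ₛₗ (starRingEnd ℂ) (RingHom.id ℂ)
    (fun φ ψ => ⟪opSqrt T hT h1 φ, opSqrt T hT h1 ψ⟫_ℂ)
    (fun _ _ _ => by simp [LinearPMap.map_add])
    (fun _ _ _ => by simp [LinearPMap.map_smul, mul_comm])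
    (fun _ _ _ => by simp [LinearPMap.map_add])
    (fun _ _ _ => by simp [LinearPMap.map_smul])

/-- `R^{1/2}` for the bounded operator `R = T⁻¹`, seen as an operator with domain `H`. -/
def resolventSqrt (T : H →ₗ.[ℂ] H) (hT : IsSelfAdjoint T) (h1 : GeOne T) : H →ₗ.[ℂ] H :=
  ofBounded (CFC.sqrt (resolventZero T hT h1))

end RelBdd

end

open RelBdd

/-!
With `R = T⁻¹` and `A = R^{1/2}`, every `ψ ∈ D(T)` is `R (T ψ)` and every `ψ ∈ D(T^{1/2})` is
`A (T^{1/2} ψ)`, so estimates relative to `T`, or to its form, are estimates on the whole space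
for `X R`, or for `A X A`; the lower-order terms are absorbed because `R` and `A` are bounded.

For operators this is immediate. For forms, `sandwich_apply` identifies `A X A` with
`φ, ψ ↦ X (A φ, A ψ)` on all of `H`. A form estimate only controls the diagonal values of `A X A`;
`norm_sesq_le_of_diag_le` recovers the other values by polarization. Conversely, by homogeneity
(`PairForm.norm_toFun_le`), `|X (ψ, ψ)| ≤ ‖A X A‖ ‖T^{1/2} ψ‖²`
(`isFormBoundedWith_of_norm_sandwich_le`), so every positive
`a ≥ ‖A X A‖` is admissible: this gives both form boundedness and the bound on the infimum.
-/

namespace RelBdd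

variable {H : Type*} [NormedAddCommGroup H] [InnerProductSpace ℂ H]

/-! ### Operator and form norms -/

theorem opNorm_lt_top_iff (T : H →ₗ.[ℂ] H) :
    opNorm T < ∞ ↔ ∃ C : ℝ, 0 ≤ C ∧ ∀ x : T.domain, ‖T x‖ ≤ C * ‖(x : H)‖ := by
  constructor
  · intro h
    refine ⟨(opNorm T).toReal, ENNReal.toReal_nonneg, fun x => ?_⟩
    have hle : ∀ y : T.domain, ‖(y : H)‖ ≤ 1 → ‖T y‖ ≤ (opNorm T).toReal := fun y hy => by
      have : ‖T y‖ₑ ≤ opNorm T :=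
        le_iSup₂_of_le (f := fun (x : T.domain) (_ : ‖(x : H)‖ ≤ 1) => ‖T x‖ₑ) y hy le_rfl
      simpa using ENNReal.toReal_mono h.ne this
    by_cases hx : (x : H) = 0
    · have : x = 0 := Subtype.ext hx
      simp [this]
    have hpos : 0 < ‖(x : H)‖ := norm_pos_iff.2 hx
    have h1 := hle (((‖(x : H)‖⁻¹ : ℝ) : ℂ) • x) (by
      rw [Submodule.coe_smul, norm_smul]
      simp [hpos.ne'])
    rw [T.map_smul, norm_smul] at h1
    simp only [Complex.norm_real, norm_inv, norm_norm] at h1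
    rwa [inv_mul_le_iff₀ hpos, mul_comm] at h1
  · rintro ⟨C, hC, h⟩
    refine lt_of_le_of_lt (iSup₂_le fun x hx => ?_) (ENNReal.ofReal_lt_top (r := C))
    rw [← ofReal_norm]
    exact ENNReal.ofReal_le_ofReal ((h x).trans (mul_le_of_le_one_right hC hx))

theorem PairForm.norm_lt_top (Y : PairForm H) (C : ℝ)
    (h : ∀ (φ : Y.left) (ψ : Y.right), ‖(φ : H)‖ ≤ 1 → ‖(ψ : H)‖ ≤ 1 → ‖Y.toFun φ ψ‖ ≤ C) :
    Y.norm < ∞ := by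
  refine lt_of_le_of_lt (iSup₂_le fun φ ψ => iSup₂_le fun hφ hψ => ?_)
    (ENNReal.ofReal_lt_top (r := C))
  rw [← ofReal_norm]
  exact ENNReal.ofReal_le_ofReal (h φ ψ hφ hψ)

theorem PairForm.norm_toFun_le (Y : PairForm H) (hY : Y.norm < ∞) (φ : Y.left) (ψ : Y.right) :
    ‖Y.toFun φ ψ‖ ≤ Y.norm.toReal * (‖(φ : H)‖ * ‖(ψ : H)‖) := by
  have hle : ∀ (φ : Y.left) (ψ : Y.right), ‖(φ : H)‖ ≤ 1 → ‖(ψ : H)‖ ≤ 1 →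
      ‖Y.toFun φ ψ‖ ≤ Y.norm.toReal := fun φ ψ hφ hψ => by
    have : ‖Y.toFun φ ψ‖ₑ ≤ Y.norm :=
      le_iSup₂_of_le φ ψ (le_iSup₂_of_le hφ hψ le_rfl)
    simpa using ENNReal.toReal_mono hY.ne this
  by_cases hx : (φ : H) = 0
  · have : φ = 0 := Subtype.ext hx
    simp [this]
  by_cases hy : (ψ : H) = 0
  · have : ψ = 0 := Subtype.ext hy
    simp [this]
  have hxp : 0 < ‖(φ : H)‖ := norm_pos_iff.2 hx
  have hyp : 0 < ‖(ψ : H)‖ := norm_pos_iff.2 hy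
  have h1 := hle (((‖(φ : H)‖⁻¹ : ℝ) : ℂ) • φ) (((‖(ψ : H)‖⁻¹ : ℝ) : ℂ) • ψ)
    (by rw [Submodule.coe_smul, norm_smul]; simp [hxp.ne'])
    (by rw [Submodule.coe_smul, norm_smul]; simp [hyp.ne'])
  rw [LinearMap.map_smulₛₗ₂, LinearMap.map_smul, norm_smul, norm_smul] at h1
  simp only [Complex.conj_ofReal, Complex.norm_real, norm_inv, norm_norm] at h1
  rw [inv_mul_le_iff₀ hxp, inv_mul_le_iff₀ hyp] at h1
  linarith

/-- Polarization: a bound on the diagonal of a sesquilinear form bounds the form. The constant is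
not optimal, but symmetry is not needed. -/
theorem norm_sesq_le_of_diag_le (Y : H →ₗ⋆[ℂ] H →ₗ[ℂ] ℂ) {c : ℝ}
    (h : ∀ φ, ‖Y φ φ‖ ≤ c * ‖φ‖ ^ 2) {φ ψ : H} (hφ : ‖φ‖ ≤ 1) (hψ : ‖ψ‖ ≤ 1) :
    ‖Y φ ψ‖ ≤ 4 * |c| := by
  have hpol : 4 * Y φ ψ = Y (φ + ψ) (φ + ψ) - Y (φ - ψ) (φ - ψ)
      - Complex.I * Y (φ + Complex.I • ψ) (φ + Complex.I • ψ)
      + Complex.I * Y (φ - Complex.I • ψ) (φ - Complex.I • ψ) := by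
    simp only [map_add, map_sub, LinearMap.add_apply, LinearMap.sub_apply,
      LinearMap.map_smulₛₗ, LinearMap.smul_apply, smul_eq_mul, Complex.conj_I, RingHom.id_apply]
    linear_combination (2 * Y φ ψ - 2 * Y ψ φ) * Complex.I_sq
  have hb : ∀ u v : H, ‖u‖ ≤ 1 → ‖v‖ ≤ 1 → ‖Y (u + v) (u + v)‖ ≤ 4 * |c| := fun u v hu hv => by
    have h1 : ‖u + v‖ ≤ 2 := (norm_add_le u v).trans (by linarith)
    have h2 : ‖u + v‖ ^ 2 ≤ 4 := by nlinarith [norm_nonneg (u + v)]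
    calc ‖Y (u + v) (u + v)‖ ≤ c * ‖u + v‖ ^ 2 := h _
      _ ≤ |c| * ‖u + v‖ ^ 2 := by gcongr; exact le_abs_self c
      _ ≤ |c| * 4 := by gcongr
      _ = 4 * |c| := mul_comm _ _
  have hI : ‖Complex.I • ψ‖ ≤ 1 := by simpa [norm_smul] using hψ
  have e1 := hb φ ψ hφ hψ
  have e2 := hb φ (-ψ) hφ (by simpa using hψ)
  have e3 := hb φ (Complex.I • ψ) hφ hI
  have e4 := hb φ (-(Complex.I • ψ)) hφ (by simpa using hI)
  rw [← sub_eq_add_neg] at e2 e4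
  have h4 : ‖4 * Y φ ψ‖ ≤ 4 * |c| + 4 * |c| + 4 * |c| + 4 * |c| := by
    rw [hpol]
    refine (norm_add_le _ _).trans (add_le_add ((norm_sub_le _ _).trans
      (add_le_add ((norm_sub_le _ _).trans (add_le_add e1 e2)) ?_)) ?_)
    · simpa using e3
    · simpa using e4
  rw [norm_mul, Complex.norm_ofNat] at h4
  linarith

variable [CompleteSpace H]

/-! ### The form `A X A` for a bounded self-adjoint operator `A` -/

theorem adjoint_ofBounded {A : H →L[ℂ] H} (hA : IsSelfAdjoint A) :
    (ofBounded A).adjoint = ofBounded A := by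
  have h := A.toPMap_adjoint_eq_adjoint_toPMap_of_dense (p := ⊤) (by simp)
  rw [hA.adjoint_eq] at h
  exact h

theorem mem_domain_adjoint_ofBounded {A : H →L[ℂ] H} (hA : IsSelfAdjoint A) (φ : H) :
    φ ∈ (ofBounded A).adjoint.domain := by
  rw [adjoint_ofBounded hA]
  trivial

theorem adjoint_ofBounded_apply {A : H →L[ℂ] H} (hA : IsSelfAdjoint A)
    (φ : (ofBounded A).adjoint.domain) : (ofBounded A).adjoint φ = A φ := by
  have key : ∀ f : H →ₗ.[ℂ] H, f = ofBounded A → ∀ φ : f.domain, f φ = A φ := by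
    rintro f rfl φ
    rfl
  exact key _ (adjoint_ofBounded hA) φ

section Sandwich

variable {A : H →L[ℂ] H} {X : SesqForm H}

theorem sandwich_left_eq_top (hA : IsSelfAdjoint A) (hX : ∀ φ, A φ ∈ X.domain) :
    (sandwich (ofBounded A) X (ofBounded A)).left = ⊤ :=
  eq_top_iff.2 fun φ _ => ⟨mem_domain_adjoint_ofBounded hA φ, by
    rw [adjoint_ofBounded_apply hA]
    exact hX φ⟩

theorem sandwich_right_eq_top (hX : ∀ φ, A φ ∈ X.domain) :
    (sandwich (ofBounded A) X (ofBounded A)).right = ⊤ :=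
  eq_top_iff.2 fun φ _ => ⟨trivial, hX φ⟩

theorem sandwich_apply (hA : IsSelfAdjoint A) (hX : ∀ φ, A φ ∈ X.domain)
    (φ : (sandwich (ofBounded A) X (ofBounded A)).left)
    (ψ : (sandwich (ofBounded A) X (ofBounded A)).right) :
    (sandwich (ofBounded A) X (ofBounded A)).toFun φ ψ =
      X.toFun ⟨A φ, hX φ⟩ ⟨A ψ, hX ψ⟩ := by
  have h : restr (ofBounded A).adjoint X.domain φ = ⟨A φ, hX φ⟩ :=
    Subtype.ext (adjoint_ofBounded_apply hA ⟨φ, φ.2.fst⟩)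
  change X.toFun (restr (ofBounded A).adjoint X.domain φ) (restr (ofBounded A) X.domain ψ) = _
  rw [h]
  rfl

theorem sandwich_isSymm (hA : IsSelfAdjoint A) (hX : ∀ φ, A φ ∈ X.domain) (hs : X.IsSymm) :
    (sandwich (ofBounded A) X (ofBounded A)).IsSymm := by
  refine ⟨(sandwich_left_eq_top hA hX).trans (sandwich_right_eq_top hX).symm, fun φ ψ => ?_⟩
  rw [sandwich_apply hA hX, sandwich_apply hA hX]
  exact hs _ _

/-- If the form `φ ↦ X (A φ, A φ)` is bounded on the diagonal, then `A X A` is bounded. -/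
theorem sandwich_isBounded_of_diag_le (hA : IsSelfAdjoint A) (hX : ∀ φ, A φ ∈ X.domain) {c : ℝ}
    (h : ∀ φ, ‖X.toFun ⟨A φ, hX φ⟩ ⟨A φ, hX φ⟩‖ ≤ c * ‖φ‖ ^ 2) :
    (sandwich (ofBounded A) X (ofBounded A)).IsBounded := by
  refine PairForm.norm_lt_top _ (4 * |c|) fun φ ψ hφ hψ => ?_
  rw [sandwich_apply hA hX]
  let B : H →ₗ[ℂ] X.domain := (A : H →ₗ[ℂ] H).codRestrict X.domain hX
  exact norm_sesq_le_of_diag_le ((X.toFun.comp B).compl₂ B) h hφ hψ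

end Sandwich

/-! ### The square roots of `T` and of its resolvent -/

variable {T : H →ₗ.[ℂ] H} (hT : IsSelfAdjoint T) (h1 : GeOne T)

theorem isSelfAdjoint_sqrt_resolventZero : IsSelfAdjoint (CFC.sqrt (resolventZero T hT h1)) :=
  (CFC.sqrt_nonneg _).isSelfAdjoint

theorem sqrt_resolventZero_mem (φ : H) :
    CFC.sqrt (resolventZero T hT h1) φ ∈ (formOf T hT h1).domain :=
  LinearPMap.mem_domain_of_mem_graph
    (((isOpSqrt_opSqrt hT h1).graph_iff hT h1 _ φ).2 rfl)

theorem opSqrt_sqrt_resolventZero (φ : H)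
    (h : CFC.sqrt (resolventZero T hT h1) φ ∈ (opSqrt T hT h1).domain) :
    opSqrt T hT h1 ⟨CFC.sqrt (resolventZero T hT h1) φ, h⟩ = φ :=
  LinearPMap.mem_graph_snd_inj _ (LinearPMap.mem_graph _ ⟨_, h⟩)
    (((isOpSqrt_opSqrt hT h1).graph_iff hT h1 _ φ).2 rfl) rfl

theorem sqrt_resolventZero_opSqrt (ψ : (opSqrt T hT h1).domain) :
    CFC.sqrt (resolventZero T hT h1) (opSqrt T hT h1 ψ) = ψ :=
  (((isOpSqrt_opSqrt hT h1).graph_iff hT h1 _ _).1 (LinearPMap.mem_graph _ ψ)).symm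

theorem re_formOf_self (ψ : (formOf T hT h1).domain) :
    ((formOf T hT h1).toFun ψ ψ).re = ‖opSqrt T hT h1 ψ‖ ^ 2 :=
  inner_self_eq_norm_sq (𝕜 := ℂ) (opSqrt T hT h1 ψ)

theorem re_formOf_sqrt_resolventZero (φ : H)
    (h : CFC.sqrt (resolventZero T hT h1) φ ∈ (formOf T hT h1).domain) :
    ((formOf T hT h1).toFun ⟨_, h⟩ ⟨_, h⟩).re = ‖φ‖ ^ 2 :=
  (re_formOf_self hT h1 _).trans
    (congrArg (‖·‖ ^ 2) (opSqrt_sqrt_resolventZero hT h1 φ h))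

/-! ### Relative boundedness -/

theorem isOpBounded_iff {X : H →ₗ.[ℂ] H} (hX : X.domain = T.domain) :
    IsOpBounded T X ↔ opNorm (opComp X (ofBounded (resolventZero T hT h1))) < ∞ := by
  set R := resolventZero T hT h1 with hR
  rw [opNorm_lt_top_iff]
  constructor
  · rintro ⟨hD, a, b, ha, hb, h⟩
    refine ⟨a + b * ‖R‖, by positivity, fun φ => ?_⟩
    obtain ⟨v, hv, hvφ⟩ := T.mem_graph_iff.1 (graph_resolventZero hT h1 (φ : H))
    simp only at hv hvφ
    have hval : opComp X (ofBounded R) φ = X ⟨v, hD v.2⟩ :=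
      congrArg X.toFun (Subtype.ext hv.symm)
    have h2 := h v
    rw [hvφ] at h2
    rw [hval]
    have hn : ‖(v : H)‖ = ‖R φ‖ := congrArg norm hv
    rw [hn] at h2
    nlinarith [mul_le_mul_of_nonneg_left (R.le_opNorm φ) hb.le]
  · rintro ⟨C, hC, h⟩
    refine ⟨hX.ge, C + 1, 1, by positivity, one_pos, fun ψ => ?_⟩
    have hψ : (ψ : H) = R (T ψ) :=
      (graph_iff_resolventZero hT h1 _ _).1 (T.mem_graph ψ)
    have hm : T ψ ∈ (opComp X (ofBounded R)).domain := ⟨trivial, by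
      change R (T ψ) ∈ X.domain
      rw [← hψ, hX]
      exact ψ.2⟩
    have hval : opComp X (ofBounded R) ⟨T ψ, hm⟩ = X ⟨ψ, hX.ge ψ.2⟩ :=
      congrArg X.toFun (Subtype.ext hψ.symm)
    have h2 := h ⟨T ψ, hm⟩
    rw [hval] at h2
    simp only at h2
    linarith [norm_nonneg (T ψ), norm_nonneg (ψ : H)]

theorem sandwich_isBounded_of_isFormBounded {X : SesqForm H}
    (hX : ∀ φ, CFC.sqrt (resolventZero T hT h1) φ ∈ X.domain)
    (h : IsFormBounded (formOf T hT h1) X) :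
    (sandwich (resolventSqrt T hT h1) X (resolventSqrt T hT h1)).IsBounded := by
  obtain ⟨a, -, hD, b, hb, h⟩ := h
  set A := CFC.sqrt (resolventZero T hT h1) with hA
  refine sandwich_isBounded_of_diag_le (isSelfAdjoint_sqrt_resolventZero hT h1) hX
    (c := a + b * ‖A‖ ^ 2) fun φ => ?_
  have h2 := h ⟨A φ, sqrt_resolventZero_mem hT h1 φ⟩
  rw [re_formOf_sqrt_resolventZero] at h2
  have h3 : ‖A φ‖ ^ 2 ≤ ‖A‖ ^ 2 * ‖φ‖ ^ 2 := by
    rw [← mul_pow]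
    exact pow_le_pow_left₀ (norm_nonneg _) (A.le_opNorm φ) 2
  refine h2.trans ?_
  nlinarith [mul_le_mul_of_nonneg_left h3 hb.le]

/-- Every positive `a ≥ ‖R^{1/2} X R^{1/2}‖` is admissible in the relative form estimate. -/
theorem isFormBoundedWith_of_norm_sandwich_le {X : SesqForm H}
    (hX : X.domain = (formOf T hT h1).domain)
    (hfin : (sandwich (resolventSqrt T hT h1) X (resolventSqrt T hT h1)).norm < ∞) {a : ℝ}
    (ha : 0 < a)
    (hle : (sandwich (resolventSqrt T hT h1) X (resolventSqrt T hT h1)).norm.toReal ≤ a) :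
    IsFormBoundedWith (formOf T hT h1) X a := by
  refine ⟨ha, hX.ge, 1, one_pos, fun ψ => ?_⟩
  have hsa := isSelfAdjoint_sqrt_resolventZero hT h1
  have hA : ∀ φ, CFC.sqrt (resolventZero T hT h1) φ ∈ X.domain := fun φ =>
    hX.ge (sqrt_resolventZero_mem hT h1 φ)
  set φ : H := opSqrt T hT h1 ψ with hφ
  have hl : φ ∈ (sandwich (resolventSqrt T hT h1) X (resolventSqrt T hT h1)).left :=
    (sandwich_left_eq_top hsa hA).ge trivial
  have hr : φ ∈ (sandwich (resolventSqrt T hT h1) X (resolventSqrt T hT h1)).right :=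
    (sandwich_right_eq_top hA).ge trivial
  have hval : (sandwich (resolventSqrt T hT h1) X (resolventSqrt T hT h1)).toFun ⟨φ, hl⟩ ⟨φ, hr⟩ =
      X.toFun ⟨ψ, hX.ge ψ.2⟩ ⟨ψ, hX.ge ψ.2⟩ := by
    have he : (⟨CFC.sqrt (resolventZero T hT h1) φ, hA φ⟩ : X.domain) = ⟨ψ, hX.ge ψ.2⟩ :=
      Subtype.ext (sqrt_resolventZero_opSqrt hT h1 ψ)
    refine (sandwich_apply hsa hA ⟨φ, hl⟩ ⟨φ, hr⟩).trans ?_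
    change X.toFun ⟨CFC.sqrt (resolventZero T hT h1) φ, hA φ⟩
      ⟨CFC.sqrt (resolventZero T hT h1) φ, hA φ⟩ = _
    rw [he]
  have h2 := PairForm.norm_toFun_le _ hfin ⟨φ, hl⟩ ⟨φ, hr⟩
  rw [hval] at h2
  rw [re_formOf_self, ← hφ]
  refine h2.trans ?_
  change _ * (‖φ‖ * ‖φ‖) ≤ _
  nlinarith [mul_le_mul_of_nonneg_right hle (sq_nonneg ‖φ‖), sq_nonneg ‖(ψ : H)‖]

theorem formRelBound_le_norm_sandwich {X : SesqForm H}
    (hX : X.domain = (formOf T hT h1).domain)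
    (hfin : (sandwich (resolventSqrt T hT h1) X (resolventSqrt T hT h1)).norm < ∞) :
    formRelBound (formOf T hT h1) X ≤
      (sandwich (resolventSqrt T hT h1) X (resolventSqrt T hT h1)).norm := by
  -- The norm may be `0`, which is not admissible itself, so it is approached from above.
  refine ENNReal.le_of_forall_pos_le_add fun ε hε _ => ?_
  have hε' : (0 : ℝ) < ε := hε
  refine (iInf₂_le _ (isFormBoundedWith_of_norm_sandwich_le hT h1 hX hfin
    (add_pos_of_nonneg_of_pos ENNReal.toReal_nonneg hε')
    (le_add_of_nonneg_right hε'.le))).trans (le_of_eq ?_)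
  rw [ENNReal.ofReal_add ENNReal.toReal_nonneg hε'.le, ENNReal.ofReal_toReal hfin.ne,
    ENNReal.ofReal_coe_nnreal]

end RelBdd

theorem lemma1 {H : Type*} [NormedAddCommGroup H] [InnerProductSpace ℂ H] [CompleteSpace H]
    (H₀ : H →ₗ.[ℂ] H) (hsa : IsSelfAdjoint H₀) (hge : GeOne H₀) :
    (∀ X : H →ₗ.[ℂ] H, X.domain = H₀.domain → IsSymmetricOp X →
      (IsOpBounded H₀ X ↔
        opNorm
          (opComp X (ofBounded (resolventZero H₀ hsa hge))) < ∞)) ∧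
    (∀ X : SesqForm H, X.domain = (formOf H₀ hsa hge).domain → X.IsSymm →
      (IsFormBounded (formOf H₀ hsa hge) X ↔
        (sandwich (resolventSqrt H₀ hsa hge) X
            (resolventSqrt H₀ hsa hge)).IsEverywhereDefined ∧
        (sandwich (resolventSqrt H₀ hsa hge) X
            (resolventSqrt H₀ hsa hge)).IsSymm ∧
        (sandwich (resolventSqrt H₀ hsa hge) X
            (resolventSqrt H₀ hsa hge)).IsBounded) ∧
      ((sandwich (resolventSqrt H₀ hsa hge) X
            (resolventSqrt H₀ hsa hge)).norm < ∞ →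
        formRelBound (formOf H₀ hsa hge) X ≤
          (sandwich (resolventSqrt H₀ hsa hge) X
            (resolventSqrt H₀ hsa hge)).norm)) := by
  refine ⟨fun X hX _ => isOpBounded_iff hsa hge hX, fun X hX hs =>
    ⟨⟨fun h => ?_, fun h => ?_⟩, formRelBound_le_norm_sandwich hsa hge hX⟩⟩
  · have hA := isSelfAdjoint_sqrt_resolventZero hsa hge
    have hR : ∀ φ, CFC.sqrt (resolventZero H₀ hsa hge) φ ∈ X.domain := fun φ =>
      hX.ge (sqrt_resolventZero_mem hsa hge φ)
    exact ⟨⟨sandwich_left_eq_top hA hR, sandwich_right_eq_top hR⟩, sandwich_isSymm hA hR hs,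
      sandwich_isBounded_of_isFormBounded hsa hge hR h⟩
  · exact ⟨_, isFormBoundedWith_of_norm_sandwich_le hsa hge hX h.2.2
      (add_pos_of_nonneg_of_pos ENNReal.toReal_nonneg one_pos)
      (le_add_of_nonneg_right zero_le_one)⟩
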